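/- All spaces are Hausdorff. A LOTS is a linearly ordered set with its order topology; a space is scattered if every non-empty subset $A$ has a point that is isolated in the subspace $A$; a Cantor subset of a space is a subspace homeomorphic to the Cantor set. A compact space $X$ has the Complex Stone--Weierstrass Property (CSWP) if every complex subalgebra of $C(X,\mathbb{C})$ (continuous complex-valued functions, supremum norm) that separates the points of $X$ and contains the constant functions is dense in $C(X,\mathbb{C})$. Theorem. If $L$ is a compact LOTS which does not contain a Cantor subset, and $S$ is a compact scattered space, then $L \times S$ has the CSWP. -/

import Mathlib

/-- `X` contains a Cantor subset: some subspace of `X` is homeomorphic to the Cantor space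
`2^ℕ` (equivalently, to the middle-third Cantor set). -/
def ContainsCantorSubset (X : Type*) [TopologicalSpace X] : Prop :=
  ∃ K : Set X, Nonempty (K ≃ₜ (ℕ → Bool))

/-- `X` is scattered: every non-empty subset `A` of `X` has a point which is isolated
in the subspace `A`. -/
def IsScatteredSpace (X : Type*) [TopologicalSpace X] : Prop :=
  ∀ A : Set X, A.Nonempty → ∃ x ∈ A, ∃ U : Set X, IsOpen U ∧ U ∩ A = {x}

/-- The Complex Stone-Weierstrass Property of a compact space `X`: every complex subalgebra of
`C(X, ℂ)` which contains the constants (as every `Subalgebra ℂ` does) and separates the points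
of `X` is dense in `C(X, ℂ)`. For compact `X` the topology of `C(X, ℂ)` is the one given by the
supremum norm. No closure under complex conjugation is required of the subalgebra. -/
def HasCSWP (X : Type*) [TopologicalSpace X] [CompactSpace X] : Prop :=
  ∀ A : Subalgebra ℂ C(X, ℂ), A.SeparatesPoints → Dense (A : Set C(X, ℂ))

open Set Topology

/-! If `A` is not dense, Krein–Milman yields a nonzero extreme point `φ` of the annihilator ball.
Let `H` be its support. A function of `A` close to `{0, 1}` on `H` becomes nearly idempotent there
under `smoothStep`; multiplying by the limit preserves annihilation of `A`, so extremality makes the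
limit constant on `H` (`eq_const_of_extreme`). This triviality passes to a minimal closed boundary
`B` (`HasTrivialIdempotents.boundary`), where every relatively open set carries a peak function.

Scatteredness of `S` isolates a slice `K` of `B` that is relatively open in `B` and is a closed
subset of `L`. The claim is that `B` is a point. An isolated point of `K` gives this at once, since
powers of a peak function approximate its indicator. Otherwise the variation of `φ` is a monotone
function on `K` whose two-point fibers are jumps. As `K` has no Cantor subset,
`exists_isOpen_dense_covBy` finds an open set in which jumps are dense, with separating functions of
uniformly bounded norm that are close to step functions on the whole set. Two such jumps near a peak
give a nontrivial approximate idempotent `f * (1 - f') * g ^ m`, a contradiction.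

Once `B` is a point, `A` is constant on `H`, so `H` is that point too, and `φ 1 = 0` forces `φ = 0`.
-/

/-! ### Compact ordered spaces and Cantor schemes -/

theorem IsClosed.orderTopology_subtype {L : Type*} [LinearOrder L] [TopologicalSpace L]
    [OrderTopology L] [CompactSpace L] {K : Set L} (hK : IsClosed K) : OrderTopology K := by
  have hc : CompactSpace K := isCompact_iff_compactSpace.mp hK.isCompact
  refine ⟨?_⟩
  have hle : (instTopologicalSpaceSubtype : TopologicalSpace K) ≤ Preorder.topology K := by
    refine le_generateFrom ?_
    rintro s ⟨a, rfl | rfl⟩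
    · exact isOpen_Ioi.preimage continuous_subtype_val
    · exact isOpen_Iio.preimage continuous_subtype_val
  -- The subspace topology is compact and refines the Hausdorff order topology, so the identity is a
  -- closed map and the two agree.
  refine le_antisymm hle ?_
  have ht2 : @T2Space K (Preorder.topology K) := by
    let := Preorder.topology K
    have : OrderTopology K := ⟨rfl⟩
    infer_instance
  have hcont : @Continuous K K instTopologicalSpaceSubtype (Preorder.topology K) id :=
    continuous_id_iff_le.mpr hle
  have hcl := @Continuous.isClosedMap K K instTopologicalSpaceSubtype (Preorder.topology K) hc ht2
    id hcont
  intro s hs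
  have := hcl sᶜ (@IsOpen.isClosed_compl _ instTopologicalSpaceSubtype _ hs)
  rw [image_id] at this
  exact (@isClosed_compl_iff _ (Preorder.topology K) _).mp this

theorem ContainsCantorSubset.of_continuous_injective {X : Type*} [TopologicalSpace X] [T2Space X]
    {φ : (ℕ → Bool) → X} (hφ : Continuous φ) (hi : Function.Injective φ) :
    ContainsCantorSubset X :=
  ⟨range φ, ⟨(hφ.isClosedEmbedding hi).isEmbedding.toHomeomorph.symm⟩⟩

/-- In a space without isolated points, every nonempty open set contains a nonempty open set on
which a monotone real function oscillates by at most `ε`. -/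
theorem exists_isOpen_subset_abs_sub_le {K : Type*} [LinearOrder K] [TopologicalSpace K]
    [OrderTopology K] [CompactSpace K] (hiso : ∀ x : K, ¬ IsOpen {x}) {F : K → ℝ}
    (hF : Monotone F) {V : Set K} (hV : IsOpen V) (hne : V.Nonempty) {ε : ℝ} (hε : 0 < ε) :
    ∃ W ⊆ V, IsOpen W ∧ W.Nonempty ∧ ∀ x ∈ W, ∀ y ∈ W, |F x - F y| ≤ ε := by
  obtain ⟨v, hv⟩ := hne
  obtain ⟨b, -, hb⟩ := isCompact_univ.exists_isLeast (α := K) ⟨v, trivial⟩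
  obtain ⟨t, -, ht⟩ := isCompact_univ.exists_isGreatest (α := K) ⟨v, trivial⟩
  have hinf : V.Infinite := by
    intro hfin
    apply hiso v
    have : ({v} : Set K) = V ∩ (V \ {v})ᶜ := by
      ext x; by_cases hx : x = v <;> simp [hx, hv]
    rw [this]
    exact hV.inter (hfin.sdiff).isClosed.isOpen_compl
  have := hinf.to_subtype
  let G : V → Icc ⌊F b / ε⌋ ⌊F t / ε⌋ := fun x => ⟨⌊F x / ε⌋, by
    constructor
    · exact Int.floor_le_floor (by gcongr; exact hF (hb trivial))
    · exact Int.floor_le_floor (by gcongr; exact hF (ht trivial))⟩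
  obtain ⟨k, hk⟩ := Finite.exists_infinite_fiber G
  have hk' : (Subtype.val '' (G ⁻¹' {k})).Infinite :=
    (Set.infinite_coe_iff.mp hk).image Subtype.val_injective.injOn
  -- With three points in one fiber, the middle one makes the open interval between the outer two
  -- nonempty, and `F` varies by at most `ε` across it.
  obtain ⟨T, hT, hcard⟩ := hk'.exists_subset_card_eq 3
  let e := T.orderIsoOfFin hcard
  have hmem : ∀ i, (e i : K) ∈ V ∧ ⌊F (e i) / ε⌋ = k := by
    intro i
    obtain ⟨y, hy, hy'⟩ := hT (e i).2
    rw [← hy']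
    exact ⟨y.2, congrArg Subtype.val hy⟩
  have h01 : (e 0 : K) < e 1 := e.strictMono (by decide)
  have h12 : (e 1 : K) < e 2 := e.strictMono (by decide)
  refine ⟨V ∩ Ioo (e 0 : K) (e 2), inter_subset_left, hV.inter isOpen_Ioo,
    ⟨e 1, (hmem 1).1, h01, h12⟩, ?_⟩
  have hbd : F (e 2) ≤ F (e 0) + ε := by
    have h0 := (hmem 0).2
    have h2 := (hmem 2).2
    have h0' := Int.floor_le (F (e 0) / ε)
    have h2' := Int.lt_floor_add_one (F (e 2) / ε)
    rw [h0, le_div_iff₀ hε] at h0'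
    rw [h2, div_lt_iff₀ hε] at h2'
    linarith
  rintro x ⟨-, hx⟩ y ⟨-, hy⟩
  have := hF hx.1.le
  have := hF hx.2.le
  have := hF hy.1.le
  have := hF hy.2.le
  rw [abs_le]
  constructor <;> linarith

theorem exists_disjoint_closure_subset {K : Type*} [TopologicalSpace K] [T3Space K]
    (hiso : ∀ x : K, ¬ IsOpen {x}) {V : Set K} (hV : IsOpen V) (hne : V.Nonempty) :
    ∃ W : Bool → Set K, (∀ i, IsOpen (W i) ∧ (W i).Nonempty ∧ closure (W i) ⊆ V) ∧
      Disjoint (closure (W false)) (closure (W true)) := by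
  obtain ⟨u, hu⟩ := hne
  obtain ⟨v, hv, huv⟩ : ∃ v ∈ V, v ≠ u := by
    by_contra! h
    exact hiso u ((Set.eq_singleton_iff_unique_mem.mpr ⟨hu, h⟩) ▸ hV)
  obtain ⟨P, huP, hP, Q, hvQ, hQ, hPQ⟩ := exists_open_nhds_disjoint_closure huv.symm
  have key : ∀ w ∈ V, ∀ P ∈ 𝓝 w, ∃ W, IsOpen W ∧ W.Nonempty ∧ closure W ⊆ V ∧ W ⊆ P := by
    intro w hw P hP
    obtain ⟨C, hC, hCc, hCV⟩ := exists_mem_nhds_isClosed_subset (hV.mem_nhds hw)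
    exact ⟨interior (C ∩ P), isOpen_interior,
      ⟨w, mem_interior_iff_mem_nhds.mpr (Filter.inter_mem hC hP)⟩,
      (closure_minimal (interior_subset.trans inter_subset_left) hCc).trans hCV,
      interior_subset.trans inter_subset_right⟩
  obtain ⟨W₀, h₀, h₀', h₀'', h₀P⟩ := key u hu P (hP.mem_nhds huP)
  obtain ⟨W₁, h₁, h₁', h₁'', h₁P⟩ := key v hv Q (hQ.mem_nhds hvQ)
  refine ⟨fun i => cond i W₁ W₀, ?_, hPQ.mono (closure_mono h₀P) (closure_mono h₁P)⟩
  rintro (_ | _)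
  · exact ⟨h₀, h₀', h₀''⟩
  · exact ⟨h₁, h₁', h₁''⟩

/-- Let `K` be a compact ordered space without isolated points and without a continuous injective
image of the Cantor set, carrying a monotone real function whose fibers have at most two points.
Assign to every jump `x ⋖ y` of `K` an open set `N x y` containing `x` and `y` and a number
`M x y`. Then there are a nonempty open `V` and `n` such that the jumps with `M x y ≤ n` and
`V ⊆ N x y` are dense in `V`. -/
theorem exists_isOpen_dense_covBy {K : Type*} [LinearOrder K] [TopologicalSpace K]
    [OrderTopology K] [CompactSpace K] [Nonempty K] (hiso : ∀ x : K, ¬ IsOpen {x})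
    (hC : ∀ φ : (ℕ → Bool) → K, Continuous φ → ¬ Function.Injective φ)
    {F : K → ℝ} (hF : Monotone F) (hF' : ∀ x y z, x < y → y < z → F x < F z)
    (N : K → K → Set K) (hN : ∀ x y, x ⋖ y → IsOpen (N x y) ∧ x ∈ N x y ∧ y ∈ N x y)
    (M : K → K → ℕ) :
    ∃ (n : ℕ) (V : Set K), IsOpen V ∧ V.Nonempty ∧ ∀ W ⊆ V, IsOpen W → W.Nonempty →
      ∃ x ∈ W, ∃ y ∈ W, x ⋖ y ∧ M x y ≤ n ∧ V ⊆ N x y := by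
  by_contra! h
  let T := {V : Set K // IsOpen V ∧ V.Nonempty}
  -- One step of the Cantor scheme: the two children have disjoint closures, small oscillation of
  -- `F`, and no jump with `M x y ≤ n` whose set `N x y` contains the parent.
  have hstep : ∀ (V : T) (n : ℕ), ∃ W : Bool → T, (∀ i, closure (W i).1 ⊆ V.1 ∧
      (∀ x ∈ closure (W i).1, ∀ y ∈ closure (W i).1, |F x - F y| ≤ 1 / ((n : ℝ) + 1)) ∧
      ∀ x ∈ closure (W i).1, ∀ y ∈ closure (W i).1, x ⋖ y → M x y ≤ n → ¬ V.1 ⊆ N x y) ∧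
      Disjoint (closure (W false).1) (closure (W true).1) := by
    rintro ⟨V, hV, hVne⟩ n
    obtain ⟨W, hWV, hW, hWne, hWb⟩ := h n V hV hVne
    obtain ⟨W', hW'W, hW', hW'ne, hW'o⟩ := exists_isOpen_subset_abs_sub_le hiso hF hW hWne
      (ε := 1 / ((n : ℝ) + 1)) (by positivity)
    obtain ⟨P, hP, hPd⟩ := exists_disjoint_closure_subset hiso hW' hW'ne
    refine ⟨fun i => ⟨P i, (hP i).1, (hP i).2.1⟩, fun i => ⟨?_, ?_, ?_⟩, hPd⟩
    · exact (hP i).2.2.trans (hW'W.trans hWV)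
    · exact fun x hx y hy => hW'o x ((hP i).2.2 hx) y ((hP i).2.2 hy)
    · exact fun x hx y hy hxy hm => hWb x (hW'W ((hP i).2.2 hx)) y (hW'W ((hP i).2.2 hy)) hxy hm
  choose step hsub hdisj using hstep
  let D : List Bool → T := fun l => List.rec ⟨univ, isOpen_univ, univ_nonempty⟩
    (fun b l V => step V l.length b) l
  have hD : ∀ b l, D (b :: l) = step (D l) l.length b := fun b l => rfl
  let C : (ℕ → Bool) → ℕ → Set K := fun f n => closure (D (PiNat.res f n)).1
  have hDs : ∀ f n, D (PiNat.res f (n + 1)) = step (D (PiNat.res f n)) n (f n) := by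
    intro f n
    rw [PiNat.res_succ, hD, PiNat.res_length]
  have hCsub : ∀ f n, C f (n + 1) ⊆ (D (PiNat.res f n)).1 := by
    intro f n
    simp only [C, hDs]
    exact (hsub _ _ _).1
  have hanti : ∀ f, Antitone (C f) := fun f =>
    antitone_nat_of_succ_le fun n => (hCsub f n).trans subset_closure
  have hne : ∀ f, (⋂ n, C f n).Nonempty := fun f =>
    IsCompact.nonempty_iInter_of_sequence_nonempty_isCompact_isClosed _
      (fun n => hanti f n.le_succ) (fun n => (D _).2.2.closure) isClosed_closure.isCompact
      (fun n => isClosed_closure)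
  have hnhds : ∀ f (U : Set K), IsOpen U → (⋂ n, C f n) ⊆ U → ∃ n, C f n ⊆ U := by
    intro f U hU hsubU
    exact exists_subset_nhds_of_isCompact (hanti f).directed_ge
      (fun n => isClosed_closure.isCompact) (fun x hx => hU.mem_nhds (hsubU hx))
  have hFeq : ∀ f, ∀ x ∈ ⋂ n, C f n, ∀ y ∈ ⋂ n, C f n, F x = F y := by
    intro f x hx y hy
    rw [← sub_eq_zero, ← abs_nonpos_iff]
    refine ge_of_tendsto' tendsto_one_div_add_atTop_nhds_zero_nat fun n => ?_
    have hx' := mem_iInter.mp hx (n + 1)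
    have hy' := mem_iInter.mp hy (n + 1)
    simp only [C, hDs] at hx' hy'
    exact (hsub _ _ _).2.1 x hx' y hy'
  -- `F` is constant on a branch intersection, so two of its points form a jump and exhaust it. By
  -- compactness `N x y` then contains a whole stage of the branch, which a late enough step
  -- forbids.
  have hlt : ∀ f, ∀ x ∈ ⋂ n, C f n, ∀ y ∈ ⋂ n, C f n, ¬ x < y := by
    intro f x hx y hy hxy
    have hcov : x ⋖ y := ⟨hxy, fun z hxz hzy => (hF' x z y hxz hzy).ne (hFeq f x hx y hy)⟩
    obtain ⟨hNo, hNx, hNy⟩ := hN x y hcov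
    obtain ⟨n, hn⟩ := hnhds f (N x y) hNo (by
      intro z hz
      rcases lt_trichotomy z x with hzx | rfl | hxz
      · exact absurd (hFeq f z hz y hy) (hF' z x y hzx hxy).ne
      · exact hNx
      · rcases lt_trichotomy y z with hyz | rfl | hzy
        · exact absurd (hFeq f x hx z hz) (hF' x y z hxy hyz).ne
        · exact hNy
        · exact absurd hzy (hcov.2 hxz))
    let k := max n (M x y)
    have hx' := mem_iInter.mp hx (k + 1)
    have hy' := mem_iInter.mp hy (k + 1)
    simp only [C, hDs] at hx' hy'
    exact (hsub _ _ _).2.2 x hx' y hy' hcov (le_max_right _ _)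
      (subset_closure.trans ((hanti f (le_max_left n (M x y))).trans hn))
  choose φ hφ using hne
  have hφmem : ∀ f n, φ f ∈ C f n := fun f n => mem_iInter.mp (hφ f) n
  have huniq : ∀ f, ∀ x ∈ ⋂ n, C f n, x = φ f := fun f x hx =>
    le_antisymm (not_lt.mp (hlt f _ (hφ f) _ hx)) (not_lt.mp (hlt f _ hx _ (hφ f)))
  have hcont : Continuous φ := by
    rw [continuous_iff_continuousAt]
    intro f
    refine (nhds_basis_opens (φ f)).tendsto_right_iff.mpr ?_
    rintro U ⟨hfU, hU⟩
    obtain ⟨n, hn⟩ := hnhds f U hU (fun x hx => huniq f x hx ▸ hfU)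
    filter_upwards [(PiNat.isOpen_cylinder (fun _ => Bool) f n).mem_nhds
      (PiNat.self_mem_cylinder f n)] with g hg
    rw [PiNat.cylinder_eq_res] at hg
    have := hφmem g n
    simp only [C, show PiNat.res g n = PiNat.res f n from hg] at this
    exact hn this
  refine hC φ hcont fun f g hfg => ?_
  by_contra hne
  obtain ⟨n, hn, hmin⟩ : ∃ n, f n ≠ g n ∧ ∀ m < n, f m = g m := by
    have hex : ∃ n, f n ≠ g n := Function.ne_iff.mp hne
    classical
    exact ⟨Nat.find hex, Nat.find_spec hex, fun m hm => not_not.mp (Nat.find_min hex hm)⟩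
  have hres : PiNat.res f n = PiNat.res g n := PiNat.res_eq_res.mpr fun m hm => hmin m hm
  have h1 := hφmem f (n + 1)
  have h2 := hφmem g (n + 1)
  rw [← hfg] at h2
  simp only [C, hDs, ← hres] at h1 h2
  have hd := hdisj (D (PiNat.res f n)) n
  cases hf : f n <;> cases hg : g n <;> simp only [hf, hg] at h1 h2 hn
  · exact hn rfl
  · exact hd.notMem_of_mem_left h1 h2
  · exact hd.notMem_of_mem_left h2 h1
  · exact hn rfl

/-! ### Extreme annihilating functionals -/

theorem Submodule.exists_annihilator_ne_zero {E : Type*} [NormedAddCommGroup E] [NormedSpace ℂ E]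
    (S : Submodule ℂ E) (hS : ¬ Dense (S : Set E)) :
    ∃ φ : StrongDual ℂ E, φ ≠ 0 ∧ ‖φ‖ ≤ 1 ∧ ∀ f ∈ S, φ f = 0 := by
  obtain ⟨x, hx⟩ : ∃ x, x ∉ closure (S : Set E) := by
    by_contra! h
    exact hS h
  obtain ⟨f, u, hf, hu⟩ := RCLike.geometric_hahn_banach_closed_point (𝕜 := ℂ)
    (S.restrictScalars ℝ).convex.closure isClosed_closure hx
  have hf0 : ∀ a ∈ S, f a = 0 := by
    intro a ha
    by_contra h
    -- The multiple of `a` is scaled so that `f` takes the value `u` on it, which the strict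
    -- inequality excludes.
    have := hf (((u : ℂ) / f a) • a) (subset_closure (S.smul_mem _ ha))
    rw [map_smul, smul_eq_mul, div_mul_cancel₀ _ h] at this
    simp at this
  have hfx : f ≠ 0 := by
    rintro rfl
    have := hf 0 (subset_closure S.zero_mem)
    simp at this hu
    linarith
  have hn : ‖f‖ ≠ 0 := norm_ne_zero_iff.mpr hfx
  refine ⟨((‖f‖⁻¹ : ℝ) : ℂ) • f, ?_, ?_, ?_⟩
  · exact smul_ne_zero (by simpa using hfx) hfx
  · rw [norm_smul, Complex.norm_real, norm_inv, norm_norm, inv_mul_cancel₀ hn]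
  · intro a ha
    simp [hf0 a ha]

/-- A subspace which is not dense is annihilated by a nonzero extreme point of the set of all
functionals of norm at most one which annihilate it. -/
theorem Submodule.exists_extreme_annihilator {E : Type*} [NormedAddCommGroup E] [NormedSpace ℂ E]
    (S : Submodule ℂ E) (hS : ¬ Dense (S : Set E)) :
    ∃ φ : StrongDual ℂ E, φ ≠ 0 ∧ ‖φ‖ ≤ 1 ∧ (∀ f ∈ S, φ f = 0) ∧
      ∀ ψ χ : StrongDual ℂ E, ‖ψ‖ ≤ 1 → ‖χ‖ ≤ 1 → (∀ f ∈ S, ψ f = 0) → (∀ f ∈ S, χ f = 0) →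
        ∀ t : ℝ, 0 < t → t < 1 → t • ψ + (1 - t) • χ = φ → ψ = φ := by
  let Φ : Set (WeakDual ℂ E) :=
    (WeakDual.toStrongDual ⁻¹' Metric.closedBall 0 1) ∩ {ψ | ∀ f ∈ S, ψ f = 0}
  have hmem : ∀ ψ : WeakDual ℂ E, ψ ∈ Φ ↔ ‖WeakDual.toStrongDual ψ‖ ≤ 1 ∧ ∀ f ∈ S, ψ f = 0 := by
    intro ψ
    simp only [Φ, mem_inter_iff, mem_preimage, mem_closedBall_zero_iff, mem_ofPred_eq]
  have hcomp : IsCompact Φ := by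
    refine (WeakDual.isCompact_closedBall 0 1).inter_right ?_
    have : {ψ : WeakDual ℂ E | ∀ f ∈ S, ψ f = 0} = ⋂ f ∈ S, {ψ | ψ f = 0} := by ext; simp
    rw [this]
    exact isClosed_biInter fun f _ => isClosed_eq (WeakDual.eval_continuous f) continuous_const
  have hconv : Convex ℝ Φ := by
    intro ψ hψ χ hχ a b ha hb hab
    rw [hmem] at hψ hχ ⊢
    refine ⟨?_, fun f hf => ?_⟩
    · have := convex_closedBall (0 : StrongDual ℂ E) 1
        (mem_closedBall_zero_iff.mpr hψ.1) (mem_closedBall_zero_iff.mpr hχ.1) ha hb hab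
      exact mem_closedBall_zero_iff.mp this
    · change a • ψ f + b • χ f = 0
      rw [hψ.2 f hf, hχ.2 f hf]; simp
  have hKM := @closure_convexHull_extremePoints (WeakDual ℂ E) _ _ _ _ _
    (WeakDual.instContinuousSMul (𝕜 := ℂ) (E := E) ℝ) WeakBilin.locallyConvexSpace Φ hcomp hconv
  obtain ⟨φ₀, hφ₀, hφ₀n, hφ₀S⟩ := S.exists_annihilator_ne_zero hS
  have hφ₀Φ : StrongDual.toWeakDual φ₀ ∈ Φ := (hmem _).mpr ⟨hφ₀n, hφ₀S⟩
  -- If `0` were the only extreme point, Krein–Milman would give `Φ ⊆ {0}`.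
  obtain ⟨φ, hφ, hφ0⟩ : ∃ φ ∈ extremePoints ℝ Φ, φ ≠ 0 := by
    by_contra! h
    have : Φ ⊆ {0} := by
      rw [← hKM]
      exact closure_minimal (convexHull_min h (convex_singleton 0)) isClosed_singleton
    exact hφ₀ (this hφ₀Φ)
  refine ⟨WeakDual.toStrongDual φ, hφ0, ((hmem φ).mp hφ.1).1, ((hmem φ).mp hφ.1).2, ?_⟩
  intro ψ χ hψ hχ hψS hχS t ht ht1 heq
  exact hφ.2 ((hmem (StrongDual.toWeakDual ψ)).mpr ⟨hψ, hψS⟩)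
    ((hmem (StrongDual.toWeakDual χ)).mpr ⟨hχ, hχS⟩)
    ⟨t, 1 - t, ht, by linarith, by ring, heq⟩

/-! ### Splitting functionals and their supports -/

theorem exists_norm_one_mul_eq_norm (z : ℂ) : ∃ c : ℂ, ‖c‖ = 1 ∧ c * z = ‖z‖ := by
  obtain ⟨c, hc, h⟩ := RCLike.exists_norm_eq_mul_self z
  exact ⟨c, hc, h.symm⟩

section Functional

variable {Y : Type*} [TopologicalSpace Y]

/-- The real function `g`, viewed as a complex function. -/
noncomputable def ContinuousMap.complexOfReal (g : C(Y, ℝ)) : C(Y, ℂ) :=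
  ⟨fun x => (g x : ℂ), Complex.continuous_ofReal.comp g.continuous⟩

@[simp] theorem ContinuousMap.complexOfReal_apply (g : C(Y, ℝ)) (x : Y) :
    g.complexOfReal x = g x := rfl

variable [CompactSpace Y]

/-- The functional `u ↦ φ (g * u)`. -/
noncomputable def ContinuousMap.dualMul (φ : StrongDual ℂ C(Y, ℂ)) (g : C(Y, ℂ)) :
    StrongDual ℂ C(Y, ℂ) :=
  φ.comp (ContinuousLinearMap.mul ℂ C(Y, ℂ) g)

@[simp] theorem ContinuousMap.dualMul_apply (φ : StrongDual ℂ C(Y, ℂ)) (g u : C(Y, ℂ)) :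
    dualMul φ g u = φ (g * u) := rfl

-- After rotating `u` and `v` so that both values are nonnegative reals, the two values add up to
-- `φ` of a pointwise convex combination of functions bounded by one.
open ContinuousMap in
theorem norm_dualMul_add_norm_dualMul_le (φ : StrongDual ℂ C(Y, ℂ)) (g : C(Y, ℝ))
    (hg : ∀ x, g x ∈ Icc (0 : ℝ) 1) :
    ‖dualMul φ g.complexOfReal‖ + ‖dualMul φ (1 - g.complexOfReal)‖ ≤ ‖φ‖ := by
  have key : ∀ u v : C(Y, ℂ), ‖u‖ ≤ 1 → ‖v‖ ≤ 1 →
      ‖dualMul φ g.complexOfReal u‖ + ‖dualMul φ (1 - g.complexOfReal) v‖ ≤ ‖φ‖ := by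
    intro u v hu hv
    obtain ⟨a, ha, hau⟩ := exists_norm_one_mul_eq_norm (dualMul φ g.complexOfReal u)
    obtain ⟨b, hb, hbv⟩ := exists_norm_one_mul_eq_norm (dualMul φ (1 - g.complexOfReal) v)
    have hw : ‖g.complexOfReal * (a • u) + (1 - g.complexOfReal) * (b • v)‖ ≤ 1 := by
      rw [ContinuousMap.norm_le _ zero_le_one]
      intro x
      have hux : ‖u x‖ ≤ 1 := (u.norm_coe_le_norm x).trans hu
      have hvx : ‖v x‖ ≤ 1 := (v.norm_coe_le_norm x).trans hv
      have h0 := (hg x).1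
      have h1 := (hg x).2
      calc ‖(g x : ℂ) * (a * u x) + (1 - (g x : ℂ)) * (b * v x)‖
          ≤ ‖(g x : ℂ) * (a * u x)‖ + ‖(1 - (g x : ℂ)) * (b * v x)‖ := norm_add_le _ _
        _ = g x * ‖u x‖ + (1 - g x) * ‖v x‖ := by
          rw [norm_mul, norm_mul, norm_mul, norm_mul, ha, hb, one_mul, one_mul, Complex.norm_real,
            Real.norm_of_nonneg h0, ← Complex.ofReal_one, ← Complex.ofReal_sub, Complex.norm_real,
            Real.norm_of_nonneg (by linarith)]
        _ ≤ 1 := by nlinarith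
    have hφw : φ (g.complexOfReal * (a • u) + (1 - g.complexOfReal) * (b • v)) =
        ((‖dualMul φ g.complexOfReal u‖ + ‖dualMul φ (1 - g.complexOfReal) v‖ : ℝ) : ℂ) := by
      rw [map_add, mul_smul_comm, mul_smul_comm, map_smul, map_smul, Complex.ofReal_add, ← hau,
        ← hbv]
      rfl
    have := φ.le_opNorm_of_le hw
    rw [hφw, Complex.norm_real, mul_one] at this
    exact (le_abs_self _).trans this
  have h1 : ∀ v : C(Y, ℂ), ‖v‖ ≤ 1 →
      ‖dualMul φ g.complexOfReal‖ ≤ ‖φ‖ - ‖dualMul φ (1 - g.complexOfReal) v‖ := by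
    intro v hv
    refine ContinuousLinearMap.opNorm_le_of_unit_norm ?_ ?_
    · have := key 0 v (by simp) hv
      rw [map_zero, norm_zero] at this
      linarith
    · intro u hu
      have := key u v hu.le hv
      linarith
  have h2 : ‖dualMul φ (1 - g.complexOfReal)‖ ≤ ‖φ‖ - ‖dualMul φ g.complexOfReal‖ := by
    refine ContinuousLinearMap.opNorm_le_of_unit_norm ?_ ?_
    · have := h1 0 (by simp)
      rw [map_zero, norm_zero] at this
      linarith
    · intro v hv
      have := h1 v hv.le
      linarith
  linarith

/-- `H` is the support of the functional `φ` on `C(Y, ℂ)`. -/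
structure IsFunctionalSupport (φ : StrongDual ℂ C(Y, ℂ)) (H : Set Y) : Prop where
  isClosed : IsClosed H
  forall_mul_eq_zero_iff : ∀ u, (∀ v, φ (u * v) = 0) ↔ ∀ x ∈ H, u x = 0

/-- The largest ideal inside the kernel of `φ` is closed, and a closed ideal of `C(Y, ℂ)` consists
of the functions vanishing on some closed set. -/
theorem exists_isFunctionalSupport [T2Space Y] (φ : StrongDual ℂ C(Y, ℂ)) :
    ∃ H, IsFunctionalSupport φ H := by
  let J : Ideal C(Y, ℂ) :=
    { carrier := {u | ∀ v, φ (u * v) = 0}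
      add_mem' := fun {a b} ha hb v => by rw [add_mul, map_add, ha, hb, add_zero]
      zero_mem' := fun v => by rw [zero_mul, map_zero]
      smul_mem' := fun c u hu v => by
        rw [smul_eq_mul, mul_comm c, mul_assoc]
        exact hu _ }
  have hJ : IsClosed (J : Set C(Y, ℂ)) := by
    have : (J : Set C(Y, ℂ)) = ⋂ v, {u | φ (u * v) = 0} := by
      ext u
      simp only [mem_iInter, mem_ofPred_eq]
      rfl
    rw [this]
    exact isClosed_iInter fun v => isClosed_eq (by fun_prop) continuous_const
  refine ⟨(ContinuousMap.setOfIdeal J)ᶜ, (ContinuousMap.setOfIdeal_open J).isClosed_compl, ?_⟩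
  intro u
  have : u ∈ J ↔ u ∈ ContinuousMap.idealOfSet ℂ (ContinuousMap.setOfIdeal J) := by
    rw [ContinuousMap.idealOfSet_ofIdeal_isClosed hJ]
  exact this.trans ContinuousMap.mem_idealOfSet

namespace IsFunctionalSupport

variable {φ : StrongDual ℂ C(Y, ℂ)} {H : Set Y}

omit [CompactSpace Y] in
theorem apply_eq_zero (hH : IsFunctionalSupport φ H) {u : C(Y, ℂ)} (hu : ∀ x ∈ H, u x = 0) :
    φ u = 0 := by
  simpa using (hH.forall_mul_eq_zero_iff u).mpr hu 1

/-- Radial truncation of `u` to the disc of radius `ε` does not change it on `H`, hence does not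
change `φ u`. -/
theorem norm_apply_le (hH : IsFunctionalSupport φ H) {u : C(Y, ℂ)} {ε : ℝ} (hε : 0 < ε)
    (hu : ∀ x ∈ H, ‖u x‖ ≤ ε) : ‖φ u‖ ≤ ‖φ‖ * ε := by
  have hpos : ∀ x, 0 < max ε ‖u x‖ := fun x => lt_max_of_lt_left hε
  let w : C(Y, ℂ) := ⟨fun x => u x * ((ε / max ε ‖u x‖ : ℝ) : ℂ), by
    refine u.continuous.mul (Complex.continuous_ofReal.comp (continuous_const.div ?_ ?_))
    · fun_prop
    · exact fun x => (hpos x).ne'⟩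
  have hw : ‖w‖ ≤ ε := by
    rw [ContinuousMap.norm_le _ hε.le]
    intro x
    change ‖u x * ((ε / max ε ‖u x‖ : ℝ) : ℂ)‖ ≤ ε
    rw [norm_mul, Complex.norm_real, Real.norm_of_nonneg (div_nonneg hε.le (hpos x).le),
      mul_div_assoc', div_le_iff₀ (hpos x), mul_comm]
    exact mul_le_mul_of_nonneg_left (le_max_right _ _) hε.le
  have huw : φ u = φ w := by
    rw [← sub_eq_zero, ← map_sub]
    refine hH.apply_eq_zero fun x hx => ?_
    change u x - u x * ((ε / max ε ‖u x‖ : ℝ) : ℂ) = 0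
    rw [max_eq_left (hu x hx), div_self hε.ne']
    simp
  rw [huw]
  exact φ.le_opNorm_of_le hw

/-- The support of an extreme annihilating functional carries no nonconstant limit of functions
of the algebra with values in the unit interval. -/
theorem eq_const_of_extreme (hH : IsFunctionalSupport φ H) {S : Submodule ℂ C(Y, ℂ)}
    (hφ : ‖φ‖ ≤ 1)
    (hext : ∀ ψ χ : StrongDual ℂ C(Y, ℂ), ‖ψ‖ ≤ 1 → ‖χ‖ ≤ 1 → (∀ f ∈ S, ψ f = 0) →
      (∀ f ∈ S, χ f = 0) → ∀ t : ℝ, 0 < t → t < 1 → t • ψ + (1 - t) • χ = φ → ψ = φ)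
    (hφS : ∀ f ∈ S, φ f = 0) (g : C(Y, ℝ)) (hg : ∀ x, g x ∈ Icc (0 : ℝ) 1)
    (hgS : ∀ f ∈ S, φ (g.complexOfReal * f) = 0) : ∃ t : ℝ, ∀ x ∈ H, g x = t := by
  set ψ := ContinuousMap.dualMul φ g.complexOfReal with hψ
  set χ := ContinuousMap.dualMul φ (1 - g.complexOfReal) with hχ
  have hsum : ψ + χ = φ := by
    ext u
    simp [hψ, hχ, sub_mul]
  have hn : ‖ψ‖ + ‖χ‖ ≤ 1 := (norm_dualMul_add_norm_dualMul_le φ g hg).trans hφ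
  -- Proportionality says that `g - ‖ψ‖` lies in the ideal defining `H`. It comes from extremality,
  -- as `φ` is a convex combination of the rescaled `ψ` and `χ`.
  suffices h : ψ = ‖ψ‖ • φ by
    refine ⟨‖ψ‖, fun x hx => ?_⟩
    have := (hH.forall_mul_eq_zero_iff (g.complexOfReal - ((‖ψ‖ : ℝ) : ℂ) • 1)).mp (by
      intro v
      have hv := congrArg (fun η : StrongDual ℂ C(Y, ℂ) => η v) h
      simp only [hψ, ContinuousMap.dualMul_apply] at hv
      rw [sub_mul, map_sub, hv, smul_mul_assoc, one_mul, map_smul]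
      simp [hψ]) x hx
    simp only [ContinuousMap.sub_apply, ContinuousMap.complexOfReal_apply,
      ContinuousMap.smul_apply, ContinuousMap.one_apply, smul_eq_mul, mul_one] at this
    exact_mod_cast sub_eq_zero.mp this
  rcases (norm_nonneg ψ).eq_or_lt with h0 | h0
  · rw [(ContinuousLinearMap.opNorm_zero_iff ψ).mp h0.symm, norm_zero]
    exact (zero_smul ℝ φ).symm
  by_cases hone : ‖ψ‖ = 1
  · have hχ0 : χ = 0 := (ContinuousLinearMap.opNorm_zero_iff χ).mp
      (le_antisymm (by linarith) (norm_nonneg χ))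
    rw [hone, one_smul, ← hsum, hχ0, add_zero]
  · have hlt : ‖ψ‖ < 1 := lt_of_le_of_ne (by linarith [norm_nonneg χ]) hone
    have := hext (‖ψ‖⁻¹ • ψ) ((1 - ‖ψ‖)⁻¹ • χ) ?_ ?_ ?_ ?_ ‖ψ‖ h0 hlt ?_
    · rw [← this, smul_inv_smul₀ h0.ne']
    · rw [norm_smul, norm_inv, norm_norm, inv_mul_cancel₀ h0.ne']
    · rw [norm_smul, norm_inv, Real.norm_of_nonneg (by linarith), inv_mul_le_iff₀ (by linarith)]
      linarith
    · intro f hf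
      simp [hψ, hgS f hf]
    · intro f hf
      simp [hχ, sub_mul, hgS f hf, hφS f hf]
    · rw [smul_inv_smul₀ h0.ne', smul_inv_smul₀ (by linarith), hsum]

end IsFunctionalSupport
end Functional

/-! ### Approximate idempotents -/

/-- The polynomial `3 a ^ 2 - 2 a ^ 3`, for which `0` and `1` are attracting fixed points. -/
def smoothStep {R : Type*} [CommRing R] (a : R) : R := 3 * a ^ 2 - 2 * a ^ 3

theorem smoothStep_one_sub {R : Type*} [CommRing R] (a : R) :
    smoothStep (1 - a) = 1 - smoothStep a := by
  simp only [smoothStep]; ring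

/-- On the disc of radius `1 / 4`, `w ^ 2 * (3 - 2 * w)` contracts by the factor `1 / 4 * (7 / 2) =
7 / 8`. -/
theorem norm_smoothStep_iterate_le {z : ℂ} (hz : ‖z‖ ≤ 1 / 4) (k : ℕ) :
    ‖smoothStep^[k] z‖ ≤ (7 / 8) ^ k / 4 := by
  induction k with
  | zero => simpa using hz
  | succ k ih =>
    rw [Function.iterate_succ_apply']
    set w := smoothStep^[k] z
    have hw : ‖w‖ ≤ 1 / 4 :=
      ih.trans (by gcongr; exact pow_le_one₀ (by norm_num) (by norm_num))
    have hfac : ‖3 - 2 * w‖ ≤ 7 / 2 := by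
      refine (norm_sub_le _ _).trans ?_
      rw [norm_mul]
      norm_num
      linarith
    calc ‖smoothStep w‖ = ‖w‖ * ‖w‖ * ‖3 - 2 * w‖ := by
          rw [← norm_mul, ← norm_mul]
          congr 1
          simp only [smoothStep]
          ring
      _ ≤ (7 / 8) ^ k / 4 * (1 / 4) * (7 / 2) := by gcongr
      _ = (7 / 8) ^ (k + 1) / 4 := by ring

theorem norm_smoothStep_iterate_sub_one_le {z : ℂ} (hz : ‖z - 1‖ ≤ 1 / 4) (k : ℕ) :
    ‖smoothStep^[k] z - 1‖ ≤ (7 / 8) ^ k / 4 := by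
  have h : smoothStep^[k] (1 - z) = 1 - smoothStep^[k] z := by
    induction k with
    | zero => rfl
    | succ k ih =>
      rw [Function.iterate_succ_apply', Function.iterate_succ_apply', ih, smoothStep_one_sub]
  rw [norm_sub_rev, ← h]
  exact norm_smoothStep_iterate_le (by rwa [norm_sub_rev]) k

section Algebra

variable {Y : Type*} [TopologicalSpace Y]

theorem smoothStep_iterate_apply (h : C(Y, ℂ)) (k : ℕ) (x : Y) :
    (smoothStep^[k] h) x = smoothStep^[k] (h x) := by
  induction k with
  | zero => rfl
  | succ k ih =>
    rw [Function.iterate_succ_apply', Function.iterate_succ_apply', ← ih]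
    rfl

theorem Subalgebra.smoothStep_iterate_mem (A : Subalgebra ℂ C(Y, ℂ)) {h : C(Y, ℂ)} (hh : h ∈ A)
    (k : ℕ) : smoothStep^[k] h ∈ A := by
  induction k with
  | zero => exact hh
  | succ k ih =>
    rw [Function.iterate_succ_apply']
    exact A.sub_mem (A.mul_mem (ofNat_mem A 3) (A.pow_mem ih 2))
      (A.mul_mem (ofNat_mem A 2) (A.pow_mem ih 3))

/-- No function of the algebra `A` is a nontrivial approximate idempotent on `H`. -/
def HasTrivialIdempotents (A : Subalgebra ℂ C(Y, ℂ)) (H : Set Y) : Prop :=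
  ∀ h ∈ A, (∀ x ∈ H, ‖h x‖ ≤ 1 / 4 ∨ ‖h x - 1‖ ≤ 1 / 4) →
    (∀ x ∈ H, ‖h x‖ ≤ 1 / 4) ∨ ∀ x ∈ H, ‖h x - 1‖ ≤ 1 / 4

/-- Every function of `A` attains the supremum of its absolute value over `H` on the closed
set `B`. -/
structure IsBoundaryIn (A : Subalgebra ℂ C(Y, ℂ)) (H B : Set Y) : Prop where
  isClosed : IsClosed B
  subset : B ⊆ H
  exists_norm_le : ∀ f ∈ A, ∀ x ∈ H, ∃ b ∈ B, ‖f x‖ ≤ ‖f b‖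

theorem exists_pow_seven_eighths_lt {ε : ℝ} (hε : 0 < ε) : ∃ k : ℕ, (7 / 8 : ℝ) ^ k < ε :=
  exists_pow_lt_of_lt_one hε (by norm_num)

/-- Near-idempotency is the smallness of `q * (q - 1)`, itself a function of `A`, so a bound on `B`
holds on all of `H`. A product of norm at most `1 / 16` has a factor of norm at most `1 / 4`. -/
theorem HasTrivialIdempotents.boundary {A : Subalgebra ℂ C(Y, ℂ)} {H B : Set Y}
    (hA : HasTrivialIdempotents A H) (hB : IsBoundaryIn A H B) : HasTrivialIdempotents A B := by
  intro h hh hhB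
  obtain ⟨k, hk⟩ := exists_pow_seven_eighths_lt (ε := 1 / 16) (by norm_num)
  set q := smoothStep^[k] h with hq
  have hqA : q ∈ A := A.smoothStep_iterate_mem hh k
  have hqs : ∀ x, ‖h x‖ ≤ 1 / 4 → ‖q x‖ ≤ 1 / 64 := fun x hx => by
    rw [hq, smoothStep_iterate_apply]
    exact (norm_smoothStep_iterate_le hx k).trans (by linarith)
  have hql : ∀ x, ‖h x - 1‖ ≤ 1 / 4 → ‖q x - 1‖ ≤ 1 / 64 := fun x hx => by
    rw [hq, smoothStep_iterate_apply]
    exact (norm_smoothStep_iterate_sub_one_le hx k).trans (by linarith)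
  have hqB : ∀ b ∈ B, ‖(q * (q - 1)) b‖ ≤ 1 / 16 := by
    intro b hb
    rw [ContinuousMap.mul_apply, ContinuousMap.sub_apply, ContinuousMap.one_apply, norm_mul]
    rcases hhB b hb with h1 | h1
    · have h2 := hqs b h1
      have h3 : ‖q b - 1‖ ≤ 2 := (norm_sub_le _ _).trans (by rw [norm_one]; linarith)
      nlinarith [norm_nonneg (q b), norm_nonneg (q b - 1)]
    · have h2 := hql b h1
      have h3 : ‖q b‖ ≤ 2 := by
        have := norm_add_le (q b - 1) 1
        rw [sub_add_cancel, norm_one] at this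
        linarith
      nlinarith [norm_nonneg (q b), norm_nonneg (q b - 1)]
  have hqH : ∀ x ∈ H, ‖q x‖ ≤ 1 / 4 ∨ ‖q x - 1‖ ≤ 1 / 4 := by
    intro x hx
    obtain ⟨b, hb, hxb⟩ := hB.exists_norm_le _ (A.mul_mem hqA (A.sub_mem hqA A.one_mem)) x hx
    have := hxb.trans (hqB b hb)
    rw [ContinuousMap.mul_apply, ContinuousMap.sub_apply, ContinuousMap.one_apply,
      norm_mul] at this
    by_contra! hc
    nlinarith
  rcases hA q hqA hqH with hs | hl
  · left
    intro b hb
    refine (hhB b hb).resolve_right fun h1 => ?_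
    have h2 := hql b h1
    have h3 := hs b (hB.subset hb)
    have := norm_sub_le (q b) (q b - 1)
    rw [sub_sub_cancel, norm_one] at this
    linarith
  · right
    intro b hb
    refine (hhB b hb).resolve_left fun h1 => ?_
    have h2 := hqs b h1
    have h3 := hl b (hB.subset hb)
    have := norm_sub_le (q b) (q b - 1)
    rw [sub_sub_cancel, norm_one] at this
    linarith

/-- The iterates of `h` stay in `A` and converge uniformly on `H` to a real function with values `0`
and `1`, so multiplication by that function keeps `φ` annihilating `A`. -/
theorem IsFunctionalSupport.hasTrivialIdempotents [CompactSpace Y] {φ : StrongDual ℂ C(Y, ℂ)}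
    {H : Set Y} (hH : IsFunctionalSupport φ H) {A : Subalgebra ℂ C(Y, ℂ)}
    (hφA : ∀ f ∈ A, φ f = 0)
    (hconst : ∀ g : C(Y, ℝ), (∀ x, g x ∈ Icc (0 : ℝ) 1) →
      (∀ f ∈ A, φ (g.complexOfReal * f) = 0) → ∃ t : ℝ, ∀ x ∈ H, g x = t) :
    HasTrivialIdempotents A H := by
  intro h hh hhH
  -- The clamp is `0` for real part at most `1 / 4` and `1` for real part at least `3 / 4`, giving a
  -- continuous extension of the limit on `H` to all of `Y`.
  let g : C(Y, ℝ) := ⟨fun x => max 0 (min 1 (2 * (h x).re - 1 / 2)), by fun_prop⟩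
  have hgs : ∀ x, ‖h x‖ ≤ 1 / 4 → g x = 0 := fun x hx => by
    have := (Complex.re_le_norm (h x)).trans hx
    exact max_eq_left ((min_le_right _ _).trans (by linarith))
  have hgl : ∀ x, ‖h x - 1‖ ≤ 1 / 4 → g x = 1 := fun x hx => by
    have := (abs_le.mp ((Complex.abs_re_le_norm (h x - 1)).trans hx)).1
    rw [Complex.sub_re, Complex.one_re] at this
    change max 0 (min 1 (2 * (h x).re - 1 / 2)) = 1
    rw [min_eq_left (by linarith), max_eq_right zero_le_one]
  obtain ⟨t, ht⟩ := hconst g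
    (fun x => ⟨le_max_left _ _, max_le zero_le_one (min_le_left _ _)⟩) (by
    intro f hf
    by_contra hne
    have hpos : 0 < ‖φ (g.complexOfReal * f)‖ := norm_pos_iff.mpr hne
    set D := ‖φ‖ * (‖f‖ + 1) with hD
    have hDnn : 0 ≤ D := by positivity
    obtain ⟨k, hk⟩ := exists_pow_seven_eighths_lt
      (ε := ‖φ (g.complexOfReal * f)‖ / (D + 1)) (by positivity)
    set q := smoothStep^[k] h with hq
    have hqA : q ∈ A := A.smoothStep_iterate_mem hh k
    have hsplit : φ (g.complexOfReal * f) = φ ((g.complexOfReal - q) * f) := by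
      rw [sub_mul, map_sub, hφA _ (A.mul_mem hqA hf), sub_zero]
    have hbound : ‖φ ((g.complexOfReal - q) * f)‖ ≤ ‖φ‖ * ((7 / 8) ^ k * (‖f‖ + 1)) := by
      refine hH.norm_apply_le (by positivity) fun x hx => ?_
      rw [ContinuousMap.mul_apply, norm_mul]
      refine mul_le_mul ?_ ((f.norm_coe_le_norm x).trans (by linarith)) (norm_nonneg _)
        (by positivity)
      rw [ContinuousMap.sub_apply, ContinuousMap.complexOfReal_apply, hq,
        smoothStep_iterate_apply]
      have hp : (0 : ℝ) ≤ (7 / 8) ^ k := by positivity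
      rcases hhH x hx with h1 | h1
      · rw [hgs x h1, Complex.ofReal_zero, zero_sub, norm_neg]
        exact (norm_smoothStep_iterate_le h1 k).trans (by linarith)
      · rw [hgl x h1, Complex.ofReal_one, norm_sub_rev]
        exact (norm_smoothStep_iterate_sub_one_le h1 k).trans (by linarith)
    rw [← hsplit] at hbound
    rw [lt_div_iff₀ (by linarith)] at hk
    have hp : (0 : ℝ) < (7 / 8) ^ k := by positivity
    have : ‖φ‖ * ((7 / 8) ^ k * (‖f‖ + 1)) = (7 / 8) ^ k * D := by rw [hD]; ring
    linarith)
  by_cases hall : ∀ x ∈ H, ‖h x‖ ≤ 1 / 4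
  · exact Or.inl hall
  · push Not at hall
    obtain ⟨y, hy, hy'⟩ := hall
    have h1 := hgl y ((hhH y hy).resolve_left (not_le.mpr hy'))
    refine Or.inr fun x hx => (hhH x hx).resolve_left fun hx' => ?_
    have := hgs x hx'
    rw [ht x hx, ← ht y hy, h1] at this
    exact one_ne_zero this

/-! ### Minimal boundaries and peak functions -/

/-- There is a minimal closed boundary. -/
theorem exists_minimal_isBoundaryIn [CompactSpace Y] (A : Subalgebra ℂ C(Y, ℂ)) {H : Set Y}
    (hH : IsClosed H) : ∃ B, Minimal (IsBoundaryIn A H) B := by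
  obtain ⟨B, -, hB⟩ := zorn_superset_nonempty {B | IsBoundaryIn A H B} (by
    intro c hc hchain hne
    refine ⟨⋂₀ c, ⟨isClosed_sInter fun B hB => (hc hB).isClosed, ?_, ?_⟩,
      fun B hB => sInter_subset_of_mem hB⟩
    · obtain ⟨B, hB⟩ := hne
      exact (sInter_subset_of_mem hB).trans (hc hB).subset
    · intro f hf x hx
      let P : Set Y := {b | ‖f x‖ ≤ ‖f b‖}
      have hP : IsClosed P := isClosed_le continuous_const (by fun_prop)
      have hcne : Nonempty c := hne.to_subtype
      have := IsCompact.nonempty_iInter_of_directed_nonempty_isCompact_isClosed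
        (fun B : c => B.1 ∩ P) (by
          rintro ⟨B, hB⟩ ⟨B', hB'⟩
          rcases hchain.total hB hB' with h | h
          · exact ⟨⟨B, hB⟩, subset_rfl, inter_subset_inter_left _ h⟩
          · exact ⟨⟨B', hB'⟩, inter_subset_inter_left _ h, subset_rfl⟩)
        (fun B => (hc B.2).exists_norm_le f hf x hx)
        (fun B => ((hc B.2).isClosed.inter hP).isCompact)
        (fun B => (hc B.2).isClosed.inter hP)
      obtain ⟨b, hb⟩ := this
      rw [mem_iInter] at hb
      exact ⟨b, fun B hB => (hb ⟨B, hB⟩).1, (hb ⟨_, hne.some_mem⟩).2⟩) H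
    ⟨hH, subset_rfl, fun f _ x hx => ⟨x, hx, le_rfl⟩⟩
  exact ⟨B, hB⟩

/-- A relatively open nonempty subset of a minimal boundary contains the points where some
function of the algebra peaks. -/
theorem exists_peak_of_minimal_isBoundaryIn [CompactSpace Y] {A : Subalgebra ℂ C(Y, ℂ)}
    {H B : Set Y} (hB : Minimal (IsBoundaryIn A H) B) {O : Set Y} (hO : IsOpen O)
    (hBO : (B ∩ O).Nonempty) :
    ∃ g ∈ A, ∃ v ∈ B ∩ O, ∃ ρ : ℝ, ρ < 1 ∧ g v = 1 ∧ (∀ b ∈ B, ‖g b‖ ≤ 1) ∧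
      ∀ b ∈ B, b ∉ O → ‖g b‖ ≤ ρ := by
  have hBc : IsClosed B := hB.1.isClosed
  have hdc : IsClosed (B \ O) := hBc.sdiff hO
  rcases (B \ O).eq_empty_or_nonempty with he | hne
  · obtain ⟨v, hv⟩ := hBO
    refine ⟨1, A.one_mem, v, hv, 0, one_pos, rfl, by simp, fun b hb hb' => ?_⟩
    exact absurd (he ▸ (⟨hb, hb'⟩ : b ∈ B \ O)) (notMem_empty b)
  have hnot : ¬ IsBoundaryIn A H (B \ O) := by
    intro h
    obtain ⟨v, hv, hvO⟩ := hBO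
    exact (hB.2 h sdiff_subset hv).2 hvO
  -- By minimality `B \ O` is not a boundary. A function witnessing this attains its maximum modulus
  -- over `B` only inside `O`, and dividing by its value there gives the peak function.
  obtain ⟨f, hf, x, hx, hfx⟩ : ∃ f ∈ A, ∃ x ∈ H, ∀ b ∈ B \ O, ‖f b‖ < ‖f x‖ := by
    by_contra! h
    exact hnot ⟨hdc, sdiff_subset.trans hB.1.subset, h⟩
  obtain ⟨v, hv, hmax⟩ := hBc.isCompact.exists_isMaxOn (hne.mono sdiff_subset)
    (f.continuous.norm.continuousOn)
  obtain ⟨w, hw, hwmax⟩ := hdc.isCompact.exists_isMaxOn hne (f.continuous.norm.continuousOn)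
  have hxv : ‖f x‖ ≤ ‖f v‖ := by
    obtain ⟨b, hb, hxb⟩ := hB.1.exists_norm_le f hf x hx
    exact hxb.trans (hmax hb)
  have hwv : ‖f w‖ < ‖f v‖ := (hfx w hw).trans_le hxv
  have hvpos : 0 < ‖f v‖ := (norm_nonneg _).trans_lt hwv
  have hval : ∀ y, ‖((f v)⁻¹ • f) y‖ = ‖f y‖ / ‖f v‖ := by
    intro y
    rw [ContinuousMap.smul_apply, smul_eq_mul, norm_mul, norm_inv, inv_mul_eq_div]
  refine ⟨(f v)⁻¹ • f, A.smul_mem hf _, v, ⟨hv, ?_⟩, ‖f w‖ / ‖f v‖,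
    (div_lt_one hvpos).mpr hwv, ?_, ?_, ?_⟩
  · by_contra hvO
    exact absurd (hfx v ⟨hv, hvO⟩) (not_lt.mpr hxv)
  · rw [ContinuousMap.smul_apply, smul_eq_mul, inv_mul_cancel₀ (norm_pos_iff.mp hvpos)]
  · intro b hb
    rw [hval]
    exact (div_le_one hvpos).mpr (hmax hb)
  · intro b hb hbO
    rw [hval]
    gcongr
    exact hwmax ⟨hb, hbO⟩

end Algebra

/-! ### Variation of a functional along the order -/

section Ordered

variable {L S : Type*} [LinearOrder L] [TopologicalSpace L] [CompactSpace L]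
  [TopologicalSpace S] [CompactSpace S]

/-- The total variation of the functional `φ` over `Iio a ×ˢ univ`. -/
noncomputable def variationBelow (φ : StrongDual ℂ C(L × S, ℂ)) (a : L) : ℝ :=
  sSup {r | ∃ u : C(L × S, ℂ), ‖u‖ ≤ 1 ∧ (∀ p : L × S, a ≤ p.1 → u p = 0) ∧ r = ‖φ u‖}

theorem le_variationBelow (φ : StrongDual ℂ C(L × S, ℂ)) {a : L} {u : C(L × S, ℂ)}
    (hu : ‖u‖ ≤ 1) (hua : ∀ p : L × S, a ≤ p.1 → u p = 0) : ‖φ u‖ ≤ variationBelow φ a := by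
  refine le_csSup ⟨‖φ‖, ?_⟩ ⟨u, hu, hua, rfl⟩
  rintro r ⟨w, hw, -, rfl⟩
  simpa using φ.le_opNorm_of_le hw

theorem variationBelow_le (φ : StrongDual ℂ C(L × S, ℂ)) {a : L} {c : ℝ}
    (h : ∀ u : C(L × S, ℂ), ‖u‖ ≤ 1 → (∀ p : L × S, a ≤ p.1 → u p = 0) → ‖φ u‖ ≤ c) :
    variationBelow φ a ≤ c := by
  refine csSup_le ⟨_, 0, by simp, fun _ _ => rfl, rfl⟩ ?_
  rintro r ⟨u, hu, hua, rfl⟩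
  exact h u hu hua

theorem variationBelow_mono (φ : StrongDual ℂ C(L × S, ℂ)) : Monotone (variationBelow φ) :=
  fun _ _ hab => variationBelow_le φ fun _ hu hua =>
    le_variationBelow φ hu fun p hp => hua p (hab.trans hp)

/-- Since `(b, s)` is in the support, `φ` is nonzero on some `w` living over `Ioo a c`. Any
competitor for `a` vanishes where `w` does not, so adding a normalized multiple of `w` keeps norm
one and gains a fixed `δ`. -/
theorem IsFunctionalSupport.variationBelow_lt [OrderTopology L] [T2Space S]
    {φ : StrongDual ℂ C(L × S, ℂ)}
    {H : Set (L × S)} (hH : IsFunctionalSupport φ H) {a b c : L} {s : S} (hab : a < b) (hbc : b < c)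
    (hb : (b, s) ∈ H) : variationBelow φ a < variationBelow φ c := by
  obtain ⟨g, hg0, hg1, -⟩ := exists_continuous_zero_one_of_isClosed
    (s := {p : L × S | p.1 ∉ Ioo a c}) (t := {(b, s)})
    (isOpen_Ioo.preimage continuous_fst).isClosed_compl isClosed_singleton (by
      rw [disjoint_singleton_right]
      exact fun h => h ⟨hab, hbc⟩)
  obtain ⟨v, hv⟩ : ∃ v, φ (g.complexOfReal * v) ≠ 0 := by
    by_contra! h
    have h0 := (hH.forall_mul_eq_zero_iff _).mp h _ hb
    have h1 : g (b, s) = 1 := hg1 rfl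
    rw [ContinuousMap.complexOfReal_apply, h1] at h0
    simp at h0
  set w := g.complexOfReal * v with hw
  have hw0 : ∀ p : L × S, p.1 ∉ Ioo a c → w p = 0 := by
    intro p hp
    have : g p = 0 := hg0 hp
    rw [hw, ContinuousMap.mul_apply, ContinuousMap.complexOfReal_apply, this]
    simp
  have hwn : 0 < ‖w‖ := norm_pos_iff.mpr fun h => hv (by rw [h, map_zero])
  set δ := ‖φ w‖ / ‖w‖ with hδ
  have hδpos : 0 < δ := div_pos (norm_pos_iff.mpr hv) hwn
  suffices h : variationBelow φ a ≤ variationBelow φ c - δ by linarith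
  refine variationBelow_le φ fun u hu hua => ?_
  obtain ⟨α, hα, hαu⟩ := exists_norm_one_mul_eq_norm (φ u)
  obtain ⟨β, hβ, hβw⟩ := exists_norm_one_mul_eq_norm (φ w)
  have hsum : φ (α • u + (β / (‖w‖ : ℂ)) • w) = ((‖φ u‖ + δ : ℝ) : ℂ) := by
    rw [map_add, map_smul, map_smul, smul_eq_mul, smul_eq_mul, hαu, div_mul_eq_mul_div, hβw, hδ]
    push_cast
    rfl
  have hle : ‖α • u + (β / (‖w‖ : ℂ)) • w‖ ≤ 1 := by
    rw [ContinuousMap.norm_le _ zero_le_one]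
    intro p
    simp only [ContinuousMap.add_apply, ContinuousMap.smul_apply, smul_eq_mul]
    by_cases hp : a ≤ p.1
    · rw [hua p hp, mul_zero, zero_add, norm_mul, norm_div, hβ, Complex.norm_real, norm_norm,
        one_div, inv_mul_le_iff₀ hwn, mul_one]
      exact w.norm_coe_le_norm p
    · rw [hw0 p fun h => hp h.1.le, mul_zero, add_zero, norm_mul, hα, one_mul]
      exact (u.norm_coe_le_norm p).trans hu
  have := le_variationBelow φ (a := c) hle (by
    intro p hp
    simp only [ContinuousMap.add_apply, ContinuousMap.smul_apply, smul_eq_mul]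
    rw [hua p ((hab.trans hbc).le.trans hp), hw0 p fun h => absurd h.2 (not_lt.mpr hp)]
    simp)
  rw [hsum, Complex.norm_real, Real.norm_of_nonneg (by positivity)] at this
  linarith

end Ordered

/-! ### Jumps and nontrivial idempotents -/

section Jumps

variable {Y K : Type*} [TopologicalSpace Y]

theorem Subalgebra.exists_apply_eq_zero_one {A : Subalgebra ℂ C(Y, ℂ)} (hA : A.SeparatesPoints)
    {p q : Y} (hpq : p ≠ q) : ∃ f ∈ A, f p = 0 ∧ f q = 1 := by
  obtain ⟨_, ⟨f, hf, rfl⟩, hne⟩ := hA hpq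
  have hsub : f q - f p ≠ 0 := sub_ne_zero.mpr (Ne.symm hne)
  refine ⟨(f q - f p)⁻¹ • (f - algebraMap ℂ _ (f p)),
    A.smul_mem (A.sub_mem hf (A.algebraMap_mem _)) _, ?_, ?_⟩
  · simp
  · simp [inv_mul_cancel₀ hsub]

/-- High powers of `g` approximate the indicator of `{v}` on `B`. -/
theorem HasTrivialIdempotents.eq_singleton_of_peak {A : Subalgebra ℂ C(Y, ℂ)} {B : Set Y}
    (hA : HasTrivialIdempotents A B) {g : C(Y, ℂ)} (hg : g ∈ A) {v : Y} (hv : v ∈ B)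
    (hgv : g v = 1) {ρ : ℝ} (hρ1 : ρ < 1) (hρ : ∀ b ∈ B, b ≠ v → ‖g b‖ ≤ ρ) :
    B = {v} := by
  obtain ⟨n, hn⟩ := exists_pow_lt_of_lt_one (show (0 : ℝ) < 1 / 4 by norm_num) hρ1
  have hoff : ∀ b ∈ B, b ≠ v → ‖(g ^ n) b‖ ≤ 1 / 4 := fun b hb hbv => by
    rw [ContinuousMap.pow_apply, norm_pow]
    exact (pow_le_pow_left₀ (norm_nonneg _) (hρ b hb hbv) n).trans hn.le
  have hon : (g ^ n) v = 1 := by rw [ContinuousMap.pow_apply, hgv, one_pow]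
  refine eq_singleton_iff_unique_mem.mpr ⟨hv, fun b hb => ?_⟩
  by_contra hbv
  rcases hA (g ^ n) (A.pow_mem hg n) (fun x hx => by
    by_cases hxv : x = v
    · right
      rw [hxv, hon]
      norm_num
    · exact Or.inl (hoff x hx hxv)) with h | h
  · have := h v hv
    rw [hon] at this
    norm_num at this
  · have h1 := h b hb
    have h2 := hoff b hb hbv
    have := norm_sub_le ((g ^ n) b) ((g ^ n) b - 1)
    rw [sub_sub_cancel, norm_one] at this
    linarith

theorem norm_mul_one_sub_mul_sub_one_le {a b c : ℂ} (ha : ‖a - 1‖ ≤ 1 / 16) (hb : ‖b‖ ≤ 1 / 16)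
    (hc : ‖c - 1‖ ≤ 1 / 16) : ‖a * (1 - b) * c - 1‖ ≤ 1 / 4 := by
  have h1 : a * (1 - b) * c - 1 =
      (a - 1) * ((1 - b) * c) + (-b) * c + (c - 1) := by ring
  have hc' : ‖c‖ ≤ 17 / 16 := by
    have := norm_add_le (c - 1) 1
    rw [sub_add_cancel, norm_one] at this
    linarith
  have hb' : ‖1 - b‖ ≤ 17 / 16 := (norm_sub_le _ _).trans (by rw [norm_one]; linarith)
  rw [h1]
  calc ‖(a - 1) * ((1 - b) * c) + (-b) * c + (c - 1)‖
      ≤ ‖a - 1‖ * (‖1 - b‖ * ‖c‖) + ‖b‖ * ‖c‖ + ‖c - 1‖ := by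
        refine (norm_add₃_le).trans ?_
        rw [norm_mul, norm_mul, norm_mul, norm_neg]
    _ ≤ 1 / 16 * (17 / 16 * (17 / 16)) + 1 / 16 * (17 / 16) + 1 / 16 := by gcongr
    _ ≤ 1 / 4 := by norm_num

theorem norm_mul_one_sub_mul_le {a b c : ℂ} (ha : ‖a‖ ≤ 17 / 16) (hb : ‖1 - b‖ ≤ 17 / 16)
    (hc : ‖c‖ ≤ 1) (hab : ‖a‖ ≤ 1 / 16 ∨ ‖1 - b‖ ≤ 1 / 16) : ‖a * (1 - b) * c‖ ≤ 1 / 4 := by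
  rw [norm_mul, norm_mul]
  rcases hab with h | h
  · calc ‖a‖ * ‖1 - b‖ * ‖c‖ ≤ 1 / 16 * (17 / 16) * 1 := by gcongr
      _ ≤ 1 / 4 := by norm_num
  · calc ‖a‖ * ‖1 - b‖ * ‖c‖ ≤ 17 / 16 * (1 / 16) * 1 := by gcongr
      _ ≤ 1 / 4 := by norm_num

variable [LinearOrder K]

/-- The function `f` is close to the characteristic function of `Ici y` at `z`. -/
def NearStep (i : K → Y) (f : C(Y, ℂ)) (x y z : K) : Prop :=
  (z ≤ x ∧ ‖f (i z)‖ < 1 / 16) ∨ (y ≤ z ∧ ‖f (i z) - 1‖ < 1 / 16)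

theorem NearStep.norm_le {i : K → Y} {f : C(Y, ℂ)} {x y z : K} (h : NearStep i f x y z)
    (hxy : x < y) (hz : z ≤ x) : ‖f (i z)‖ ≤ 1 / 16 := by
  rcases h with h | h
  · exact h.2.le
  · exact absurd (hz.trans_lt hxy) (not_lt.mpr h.1)

theorem NearStep.norm_sub_one_le {i : K → Y} {f : C(Y, ℂ)} {x y z : K} (h : NearStep i f x y z)
    (hxy : x < y) (hz : y ≤ z) : ‖f (i z) - 1‖ ≤ 1 / 16 := by
  rcases h with h | h
  · exact absurd (hxy.trans_le hz) (not_lt.mpr h.1)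
  · exact h.2.le

theorem NearStep.norm_le_and {i : K → Y} {f : C(Y, ℂ)} {x y z : K} (h : NearStep i f x y z) :
    ‖f (i z)‖ ≤ 17 / 16 ∧ ‖1 - f (i z)‖ ≤ 17 / 16 := by
  rcases h with ⟨-, h⟩ | ⟨-, h⟩
  · have := norm_sub_le 1 (f (i z))
    rw [norm_one] at this
    constructor <;> linarith
  · have := norm_add_le (f (i z) - 1) 1
    rw [sub_add_cancel, norm_one] at this
    rw [norm_sub_rev]
    constructor <;> linarith

/-- Two jumps close to each other, with functions of bounded norm separating them, produce together
with a peak function a nontrivial approximate idempotent. -/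
theorem HasTrivialIdempotents.false_of_jumps {A : Subalgebra ℂ C(Y, ℂ)} {B : Set Y}
    (hA : HasTrivialIdempotents A B) {i : K → Y} (hiB : ∀ k, i k ∈ B) {V : Set K}
    {g f f' : C(Y, ℂ)} (hg : g ∈ A) (hf : f ∈ A) (hf' : f' ∈ A) {x y x' y' : K} (hxy : x ⋖ y)
    (hxy' : x' ⋖ y') (hlt : y ≤ x') (hx : x ∈ V) (hy : y ∈ V)
    (hV : ∀ z ∈ V, NearStep i f x y z) (hV' : ∀ z ∈ V, NearStep i f' x' y' z)
    (hg1 : ∀ b ∈ B, ‖g b‖ ≤ 1)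
    (hgV : ∀ b ∈ B, b ∉ i '' V → ‖f b * (1 - f' b) * g b‖ ≤ 1 / 4)
    (hnear : ∀ z ∈ Icc y x', ‖g (i z) - 1‖ ≤ 1 / 16) : False := by
  have hsmall : ∀ z ∈ V, z ≤ x → ‖f (i z) * (1 - f' (i z)) * g (i z)‖ ≤ 1 / 4 := fun z hz hzx =>
    norm_mul_one_sub_mul_le (hV z hz).norm_le_and.1 (hV' z hz).norm_le_and.2 (hg1 _ (hiB z))
      (Or.inl ((hV z hz).norm_le hxy.lt hzx))
  have hbig : ∀ z ∈ V, y ≤ z → z ≤ x' → ‖f (i z) * (1 - f' (i z)) * g (i z) - 1‖ ≤ 1 / 4 :=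
    fun z hz hyz hzx => norm_mul_one_sub_mul_sub_one_le ((hV z hz).norm_sub_one_le hxy.lt hyz)
      ((hV' z hz).norm_le hxy'.lt hzx) (hnear z ⟨hyz, hzx⟩)
  have hmem : f * (1 - f') * g ∈ A := A.mul_mem (A.mul_mem hf (A.sub_mem A.one_mem hf')) hg
  -- On `B` the product approximates the indicator of the part of `i '' V` between `y` and `x'`. It
  -- is near `1` at `i y` and near `0` at `i x`, so neither alternative can hold.
  rcases hA _ hmem (by
    intro b hb
    change ‖f b * (1 - f' b) * g b‖ ≤ 1 / 4 ∨ ‖f b * (1 - f' b) * g b - 1‖ ≤ 1 / 4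
    by_cases hbV : b ∈ i '' V
    · obtain ⟨z, hz, rfl⟩ := hbV
      rcases le_or_gt z x with h1 | h1
      · exact Or.inl (hsmall z hz h1)
      rcases le_or_gt z x' with h2 | h2
      · exact Or.inr (hbig z hz (hxy.ge_of_gt h1) h2)
      · refine Or.inl (norm_mul_one_sub_mul_le (hV z hz).norm_le_and.1 (hV' z hz).norm_le_and.2
          (hg1 _ (hiB z)) (Or.inr ?_))
        rw [norm_sub_rev]
        exact (hV' z hz).norm_sub_one_le hxy'.lt (hxy'.ge_of_gt h2)
    · exact Or.inl (hgV b hb hbV)) with h | h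
  · have h1 : ‖f (i y) * (1 - f' (i y)) * g (i y)‖ ≤ 1 / 4 := h _ (hiB y)
    have h2 := hbig y hy le_rfl hlt
    have := norm_sub_le (f (i y) * (1 - f' (i y)) * g (i y))
      (f (i y) * (1 - f' (i y)) * g (i y) - 1)
    rw [sub_sub_cancel, norm_one] at this
    linarith
  · have h1 : ‖f (i x) * (1 - f' (i x)) * g (i x) - 1‖ ≤ 1 / 4 := h _ (hiB x)
    have h2 := hsmall x hx le_rfl
    have := norm_sub_le (f (i x) * (1 - f' (i x)) * g (i x))
      (f (i x) * (1 - f' (i x)) * g (i x) - 1)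
    rw [sub_sub_cancel, norm_one] at this
    linarith

variable [TopologicalSpace K] [OrderTopology K]

/-- Across a jump, `Iic x = Iio y` and `Ici y = Ioi x` are open. -/
theorem isOpen_nearStep {i : K → Y} (hi : Continuous i) (f : C(Y, ℂ)) {x y : K} (hxy : x ⋖ y) :
    IsOpen {z | NearStep i f x y z} := by
  have h0 : Continuous fun z => ‖f (i z)‖ := by fun_prop
  have h1 : Continuous fun z => ‖f (i z) - 1‖ := by fun_prop
  refine IsOpen.union (IsOpen.inter ?_ (isOpen_lt h0 continuous_const))
    (IsOpen.inter ?_ (isOpen_lt h1 continuous_const))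
  · change IsOpen (Iic x)
    rw [← hxy.Iio_eq]
    exact isOpen_Iio
  · change IsOpen (Ici y)
    rw [← hxy.Ioi_eq]
    exact isOpen_Ioi

/-- In an ordered space without isolated points, if jumps with a property `P` are dense in the
neighborhood `V` of `v`, then every neighborhood of `v` contains an interval spanned by two of
them. -/
theorem exists_pair_covBy (hiso : ∀ x : K, ¬ IsOpen {x}) {P : K → K → Prop} {V : Set K}
    (hP : ∀ W ⊆ V, IsOpen W → W.Nonempty → ∃ x ∈ W, ∃ y ∈ W, x ⋖ y ∧ P x y)
    {U : Set K} (hU : IsOpen U) (hUV : U ⊆ V) {v : K} (hv : v ∈ U) :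
    ∃ x y x' y', x ⋖ y ∧ x' ⋖ y' ∧ P x y ∧ P x' y' ∧ y ≤ x' ∧ x ∈ U ∧ Icc y x' ⊆ U := by
  set W := interior (U.ordConnectedComponent v) with hW
  have hcU : U.ordConnectedComponent v ⊆ U := ordConnectedComponent_subset
  have hWU : W ⊆ U := interior_subset.trans hcU
  have hvW : v ∈ W :=
    mem_interior_iff_mem_nhds.mpr (ordConnectedComponent_mem_nhds.mpr (hU.mem_nhds hv))
  have hIcc : ∀ a ∈ W, ∀ b ∈ W, Icc a b ⊆ U := fun a ha b hb =>
    (OrdConnected.out inferInstance (interior_subset ha) (interior_subset hb)).trans hcU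
  obtain ⟨x, hx, y, hy, hxy, hp⟩ := hP W (hWU.trans hUV) isOpen_interior ⟨v, hvW⟩
  -- A second jump is sought away from the first; there is room, since `W = {x, y}` would make `x`
  -- isolated.
  have hne : (W \ {x, y}).Nonempty := by
    rw [nonempty_iff_ne_empty]
    intro h
    have hsub : W ⊆ {x, y} := sdiff_eq_empty.mp h
    apply hiso x
    have : ({x} : Set K) = W ∩ {y}ᶜ := by
      ext z
      constructor
      · rintro rfl
        exact ⟨hx, hxy.lt.ne⟩
      · rintro ⟨hz, hzy⟩
        exact (hsub hz).resolve_right hzy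
    rw [this]
    exact isOpen_interior.inter isOpen_compl_singleton
  obtain ⟨x', hx', y', hy', hxy', hp'⟩ := hP (W \ {x, y}) (sdiff_subset.trans (hWU.trans hUV))
    (isOpen_interior.sdiff (toFinite _).isClosed) hne
  rcases lt_trichotomy x x' with h | h | h
  · exact ⟨x, y, x', y', hxy, hxy', hp, hp', hxy.ge_of_gt h, hWU hx, hIcc y hy x' hx'.1⟩
  · exact absurd (Or.inl h.symm) hx'.2
  · exact ⟨x', y', x, y, hxy', hxy, hp', hp, hxy'.ge_of_gt h, hWU hx'.1, hIcc y' hy'.1 x hx⟩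

variable [CompactSpace K] [Nonempty K] [CompactSpace Y]

/-- An isolated point of `K` is a peak point, which settles that case. Without one, density of jumps
with uniform bounds leads to a contradiction. -/
theorem HasTrivialIdempotents.exists_eq_singleton {A : Subalgebra ℂ C(Y, ℂ)}
    (hsep : A.SeparatesPoints) {B : Set Y} (hA : HasTrivialIdempotents A B) {i : K → Y}
    (hi : Continuous i) (hinj : Function.Injective i) (hiB : ∀ k, i k ∈ B)
    (hpeak : ∀ V : Set K, IsOpen V → V.Nonempty → ∃ g ∈ A, ∃ v ∈ V, ∃ ρ : ℝ, ρ < 1 ∧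
      g (i v) = 1 ∧ (∀ b ∈ B, ‖g b‖ ≤ 1) ∧ ∀ b ∈ B, b ∉ i '' V → ‖g b‖ ≤ ρ)
    (hC : ∀ φ : (ℕ → Bool) → K, Continuous φ → ¬ Function.Injective φ)
    {F : K → ℝ} (hF : Monotone F) (hF' : ∀ x y z, x < y → y < z → F x < F z) :
    ∃ b, B = {b} := by
  by_cases hiso : ∃ x : K, IsOpen {x}
  · obtain ⟨x, hx⟩ := hiso
    obtain ⟨g, hg, v, hv, ρ, hρ1, hgv, -, hρ⟩ := hpeak {x} hx ⟨x, rfl⟩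
    obtain rfl : v = x := hv
    refine ⟨i v, hA.eq_singleton_of_peak hg (hiB v) hgv hρ1 fun b hb hbv => hρ b hb ?_⟩
    rw [image_singleton]
    exact hbv
  · exfalso
    push Not at hiso
    have hf : ∀ x y : K, ∃ f ∈ A, x ⋖ y → f (i x) = 0 ∧ f (i y) = 1 := by
      intro x y
      by_cases hxy : x ⋖ y
      · obtain ⟨f, hf, h⟩ := Subalgebra.exists_apply_eq_zero_one hsep (hinj.ne hxy.lt.ne)
        exact ⟨f, hf, fun _ => h⟩
      · exact ⟨0, A.zero_mem, fun h => absurd h hxy⟩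
    choose f hfA hf01 using hf
    obtain ⟨n, V, hV, hVne, hdense⟩ := exists_isOpen_dense_covBy hiso hC hF hF'
      (fun x y => {z | NearStep i (f x y) x y z})
      (fun x y hxy => ⟨isOpen_nearStep hi (f x y) hxy,
        Or.inl ⟨le_rfl, by rw [(hf01 x y hxy).1]; norm_num⟩,
        Or.inr ⟨le_rfl, by rw [(hf01 x y hxy).2]; norm_num⟩⟩)
      (fun x y => ⌈‖f x y‖⌉₊)
    obtain ⟨g, hg, v, hv, ρ, hρ1, hgv, hg1, hρ⟩ := hpeak V hV hVne
    -- The power must be fixed before the jumps, which are taken where `g ^ m` is near `1`. The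
    -- uniform bound `n` allows this: off `V` the product is at most `n * (1 + n) * ρ ^ m`.
    obtain ⟨m, hm⟩ := exists_pow_lt_of_lt_one
      (show (0 : ℝ) < 1 / (4 * (n * (1 + n) + 1)) by positivity) hρ1
    let U : Set K := V ∩ {z | ‖(g ^ m) (i z) - 1‖ < 1 / 16}
    have hU : IsOpen U := hV.inter (isOpen_lt (by fun_prop) continuous_const)
    have hvU : v ∈ U := ⟨hv, by
      change ‖(g ^ m) (i v) - 1‖ < 1 / 16
      rw [ContinuousMap.pow_apply, hgv]
      norm_num⟩
    obtain ⟨x, y, x', y', hxy, hxy', ⟨hM, hN⟩, ⟨hM', hN'⟩, hle, hxU, hIcc⟩ :=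
      exists_pair_covBy hiso hdense hU inter_subset_left hvU
    have hnorm : ∀ x y, ⌈‖f x y‖⌉₊ ≤ n → ∀ b, ‖f x y b‖ ≤ n := fun x y h b =>
      ((f x y).norm_coe_le_norm b).trans ((Nat.le_ceil _).trans (by exact_mod_cast h))
    refine hA.false_of_jumps hiB (A.pow_mem hg m) (hfA x y) (hfA x' y') hxy hxy' hle hxU.1
      (hIcc ⟨le_rfl, hle⟩).1 (fun z hz => hN hz) (fun z hz => hN' hz) ?_ ?_
      (fun z hz => (hIcc hz).2.le)
    · intro b hb
      rw [ContinuousMap.pow_apply, norm_pow]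
      exact pow_le_one₀ (norm_nonneg _) (hg1 b hb)
    · intro b hb hbV
      have h1 : ‖1 - f x' y' b‖ ≤ 1 + n := (norm_sub_le _ _).trans (by
        rw [norm_one]
        linarith [hnorm x' y' hM' b])
      have h2 : ‖(g ^ m) b‖ ≤ 1 / (4 * (n * (1 + n) + 1)) := by
        rw [ContinuousMap.pow_apply, norm_pow]
        exact (pow_le_pow_left₀ (norm_nonneg _) (hρ b hb hbV) m).trans hm.le
      rw [norm_mul, norm_mul]
      calc ‖f x y b‖ * ‖1 - f x' y' b‖ * ‖(g ^ m) b‖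
          ≤ n * (1 + n) * (1 / (4 * (n * (1 + n) + 1))) := by
            gcongr
            exact hnorm x y hM b
        _ ≤ 1 / 4 := by
            have hn : (0 : ℝ) ≤ n * (1 + n) := by positivity
            rw [mul_one_div, div_le_div_iff₀ (by positivity) (by norm_num)]
            linarith

end Jumps

/-! ### Conclusion -/

theorem theorem2 {L : Type*} [LinearOrder L] [TopologicalSpace L] [OrderTopology L]
    [CompactSpace L] {S : Type*} [TopologicalSpace S] [CompactSpace S] [T2Space S]
    (hL : ¬ ContainsCantorSubset L) (hS : IsScatteredSpace S) :
    HasCSWP (L × S) := by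
  intro A hsep
  by_contra hdense
  obtain ⟨φ, hφ0, hφ1, hφA, hext⟩ :=
    (Subalgebra.toSubmodule A).exists_extreme_annihilator hdense
  obtain ⟨H, hH⟩ := exists_isFunctionalSupport φ
  have hAH : HasTrivialIdempotents A H := hH.hasTrivialIdempotents hφA fun g hg hgA =>
    hH.eq_const_of_extreme hφ1 hext hφA g hg hgA
  obtain ⟨B, hB⟩ := exists_minimal_isBoundaryIn A hH.isClosed
  have hAB := hAH.boundary hB.1
  have hBne : B.Nonempty := by
    obtain ⟨x, hx⟩ : H.Nonempty := by
      rw [nonempty_iff_ne_empty]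
      rintro rfl
      exact hφ0 (ContinuousLinearMap.ext fun u => hH.apply_eq_zero fun x hx => absurd hx id)
    obtain ⟨b, hb, -⟩ := hB.1.exists_norm_le 1 A.one_mem x hx
    exact ⟨b, hb⟩
  -- An isolated point `s` of the projection makes the slice of `B` over `s` relatively open, so
  -- peak functions for open subsets of `K` come from boxes `V' ×ˢ O`.
  obtain ⟨s, hs, O, hO, hOs⟩ := hS (Prod.snd '' B) (hBne.image _)
  let K : Set L := {x | (x, s) ∈ B}
  have hK : IsClosed K := hB.1.isClosed.preimage (by fun_prop)
  have hKo : OrderTopology K := hK.orderTopology_subtype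
  have hKc : CompactSpace K := isCompact_iff_compactSpace.mp hK.isCompact
  have hKne : Nonempty K := by
    obtain ⟨⟨x, t⟩, hxt, rfl⟩ := hs
    exact ⟨⟨x, hxt⟩⟩
  have hsO : s ∈ O := (hOs.symm ▸ mem_singleton s : s ∈ O ∩ Prod.snd '' B).1
  let i : K → L × S := fun x => (x.1, s)
  have hsnd : ∀ b ∈ B, b.2 ∈ O → b.2 = s := fun b hb hbO => by
    have : b.2 ∈ O ∩ Prod.snd '' B := ⟨hbO, b, hb, rfl⟩
    rwa [hOs] at this
  obtain ⟨b, hb⟩ := hAB.exists_eq_singleton (K := K) (i := i) hsep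
    (by fun_prop) (fun x y h => Subtype.ext (congrArg Prod.fst h)) (fun x => x.2)
    (by
      intro V hV hVne
      obtain ⟨V', hV', rfl⟩ := isOpen_induced_iff.mp hV
      obtain ⟨x, hx⟩ := hVne
      obtain ⟨g, hg, v, ⟨hvB, hvO⟩, ρ, hρ1, hgv, hg1, hρ⟩ :=
        exists_peak_of_minimal_isBoundaryIn hB (hV'.prod hO) ⟨i x, x.2, hx, hsO⟩
      have hv : v = (v.1, s) := Prod.ext rfl (hsnd v hvB hvO.2)
      refine ⟨g, hg, ⟨v.1, show (v.1, s) ∈ B from hv ▸ hvB⟩, hvO.1, ρ, hρ1, (congrArg g hv).symm.trans hgv, hg1,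
        fun b hb hbV => hρ b hb fun hbO => hbV ?_⟩
      have hbs : b = (b.1, s) := Prod.ext rfl (hsnd b hb hbO.2)
      exact ⟨⟨b.1, show (b.1, s) ∈ B from hbs ▸ hb⟩, hbO.1, hbs.symm⟩)
    (fun ψ hψ hinj => hL (.of_continuous_injective (continuous_subtype_val.comp hψ)
      (Subtype.val_injective.comp hinj)))
    (F := fun x => variationBelow φ x.1) (fun x y h => variationBelow_mono φ h)
    (fun x y z hxy hyz => hH.variationBelow_lt hxy hyz (hB.1.subset y.2))
  have hAb : ∀ f ∈ A, ∀ x ∈ H, f x = f b := by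
    intro f hf x hx
    -- The function `f - f b` vanishes on the boundary `{b}`, hence on `H`.
    obtain ⟨c, hc, hxc⟩ := hB.1.exists_norm_le (f - algebraMap ℂ _ (f b))
      (A.sub_mem hf (A.algebraMap_mem _)) x hx
    rw [hb, mem_singleton_iff] at hc
    subst hc
    simpa [sub_eq_zero] using hxc
  have hbH : b ∈ H := hB.1.subset (hb ▸ mem_singleton b)
  have hHb : ∀ x ∈ H, x = b := by
    intro x hx
    by_contra hne
    obtain ⟨f, hf, hfx, hfb⟩ := Subalgebra.exists_apply_eq_zero_one hsep hne
    have := hAb f hf x hx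
    rw [hfx, hfb] at this
    exact zero_ne_one this
  refine hφ0 (ContinuousLinearMap.ext fun u => ?_)
  have h1 : φ (u - u b • 1) = 0 := hH.apply_eq_zero fun x hx => by simp [hHb x hx]
  rw [map_sub, map_smul, hφA 1 A.one_mem, smul_zero, sub_zero] at h1
  exact h1
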